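/- **Setting.** Let $\{P_\theta:\theta\in\Theta\}$, $\Theta\subseteq\mathbb R^d$, be a statistical model with densities $p_\theta$ (jointly measurable in $(\theta,z)$) with respect to a $\sigma$-finite measure $\mu$. Let $\mathcal G$ be a class of probability distributions, not necessarily in the model; for $G\in\mathcal G$ let $\theta_G\in\Theta$ be a minimizer of $\theta\mapsto \mathrm{KL}(G\,\|\,P_\theta)$ over $\Theta$. For every $n$, i.i.d. observations $Z_i\sim G$ are split into two disjoint index sets $D_1,D_2$ with $|D_2|=n$ (the sizes of $D_1$ are arbitrary), $\widehat\theta_1\in\Theta$ is an arbitrary (measurable) estimator computed from $\{Z_i:i\in D_1\}$, and for a fixed $\alpha\in(0,1)$ the universal confidence set is $$\mathrm{CI}^{\mathrm{UI}}_{n,\alpha}=\Big\{\theta\in\Theta:\ \sum_{i\in D_2}\log\frac{p_{\widehat\theta_1}(Z_i)}{p_\theta(Z_i)}\le\log(1/\alpha)\Big\}.$$ Write $\|x\|_A=\sqrt{x^\top A x}$. A modulus of continuity is a nondecreasing function $\mathbb R_+\to\mathbb R_+$ that vanishes at $0$ and is continuous there. Let $\delta_n\ge 0$ with $\delta_n\to0$.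 **Assumptions.** In (A1), (A2), (A4) it is understood that $\theta_G+h\in\Theta$ for all the $h$ that occur. * (A1) There are $G$-square integrable score functions $\dot\ell_G:\mathcal Z\to\mathbb R^d$, with $I_G:=\mathbb E_G[\dot\ell_G\dot\ell_G^\top]$, and moduli of continuity $\phi_G$ such that for all $n$, $G\in\mathcal G$, $0\le\delta\le\delta_n$, $$\sup_{\|h\|_{I_G}\le\delta}\mathbb E_G\Big[\Big(\tfrac{p_{\theta_G+h}^{1/2}}{p_{\theta_G}^{1/2}}-1-\tfrac12h^\top\dot\ell_G\Big)^2\Big]\le\phi_G(\delta),\qquad \sup_{G\in\mathcal G}\ \sup_{0<\delta\le\delta_n}\phi_G(\delta)/\delta^2\to0 .$$ * (A2) There are positive definite matrices $V_G$ and moduli of continuity $\omega_G$ such that for all $n$, $G\in\mathcal G$, $0\le\delta\le\delta_n$ and $\|h\|_{V_G}\le\delta$, the expectation $\mathbb E_G[\log(p_{\theta_G+h}/p_{\theta_G})]$ exists and is finite, and $$\sup_{\|h\|_{V_G}\le\delta}\Big|\mathbb E_G\Big[\log\tfrac{p_{\theta_G+h}}{p_{\theta_G}}\Big]+\tfrac12h^\top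 V_Gh\Big|\le\omega_G(\delta),\qquad \sup_{G\in\mathcal G}\ \sup_{0<\delta\le\delta_n}\omega_G(\delta)/\delta^2\to0 .$$ * (A3) $\displaystyle\limsup_{n\to\infty}\sup_{G\in\mathcal G}\mathbb P_G\Big(\max\Big\{\|\widehat\theta_1-\theta_G\|_{I_G},\ \|\widehat\theta_1-\theta_G\|_{V_G},\ \frac{\|\widehat\theta_1-\theta_G\|_{V_G}^2}{\|\widehat\theta_1-\theta_G\|_{I_G}}\Big\}>\delta_n\Big)=0$ (with $0/0=0$, and $a/0=\infty$ for $a>0$). * (A4) For some $p\ge2$, some $L_{n,G}\ge0$ and some moduli of continuity $\nu_{G,p}$, for all $n$, $G\in\mathcal G$, $0\le\delta\le\delta_n$, $$\sup_{\|h\|_{I_G}\le\delta}\Big(\mathbb E_G\Big|\tfrac{p_{\theta_G+h}^{1/2}}{p_{\theta_G}^{1/2}}-1-\tfrac12h^\top\dot\ell_G\Big|^p\Big)^{1/p}\le L_{n,G}\,\delta,\qquad \sup_{\|h\|_{I_G}\le\delta}\Big(\mathbb E_G\Big|\log\tfrac{p_{\theta_G+h}}{p_{\theta_G}}\Big|^{\frac{2p}{p-2}}\Big)^{\frac{p-2}{2p}}\le\nu_{G,p}(\delta)$$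 (the essential supremum if $p=2$), and $\sup_{G\in\mathcal G}\sup_{\delta\le\delta_n}\max\{L_{n,G},1\}\,\nu_{G,p}(\delta)\to0$. * (A5) $\mathbb E_G[\dot\ell_G]=0$ for all $G\in\mathcal G$ and, with $\|X\|_2=(\mathbb E_G X^2)^{1/2}$ and $0/0=0$, $$\lim_{\kappa\to\infty}\ \sup_{G\in\mathcal G}\ \sup_{t\in\mathbb R^d}\ \mathbb E_G\Big[\frac{\langle t,\dot\ell_G\rangle^2}{\|\langle t,\dot\ell_G\rangle\|_2^2}\min\Big\{1,\frac{|\langle t,\dot\ell_G\rangle|}{\kappa\|\langle t,\dot\ell_G\rangle\|_2}\Big\}\Big]=0 .$$ **Claim.** Assume (A1)–(A5), and suppose that for every $\varepsilon>0$ $$\limsup_{n\to\infty}\ \sup_{G\in\mathcal G}\ \mathbb P_G\Big(\min\Big\{n^{1/2}\|\widehat\theta_1-\theta_G\|_{I_G},\ \frac{\|\widehat\theta_1-\theta_G\|_{I_G}}{n^{1/2}\|\widehat\theta_1-\theta_G\|_{V_G}^2}\Big\}>\varepsilon\Big)=0$$ (with $0/0=0$). Then the universal confidence set is uniformly extremely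 conservative for $\theta_G$ over $\mathcal G$, $$\limsup_{n\to\infty}\ \sup_{G\in\mathcal G}\ \mathbb P_G\big(\theta_G\notin\mathrm{CI}^{\mathrm{UI}}_{n,\alpha}\big)=0,$$ and thus uniformly valid: $\limsup_{n\to\infty}\sup_{G\in\mathcal G}\big(\mathbb P_G(\theta_G\notin\mathrm{CI}^{\mathrm{UI}}_{n,\alpha})-\alpha\big)_+=0$. -/

import Mathlib

open MeasureTheory Filter Topology
open scoped NNReal ENNReal

noncomputable section

namespace UnivInf

/-- The scaled norm `‖x‖_A = √(xᵀ A x)`. -/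
def scaledNorm {d : ℕ} (A : Matrix (Fin d) (Fin d) ℝ) (x : Fin d → ℝ) : ℝ :=
  Real.sqrt (x ⬝ᵥ A.mulVec x)

/-- A modulus of continuity: a nondecreasing function on `[0, ∞)` that vanishes at `0` and is
continuous there. -/
def IsModulus (ω : ℝ≥0 → ℝ≥0) : Prop :=
  Monotone ω ∧ Tendsto ω (𝓝 0) (𝓝 0)

/-- A parametric statistical model `{P_θ : θ ∈ Θ}`, `Θ ⊆ ℝᵈ`, dominated by a `σ`-finite measure
`μ`, with `p θ` the density of `P_θ` with respect to `μ`. -/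
structure Model (𝒵 : Type*) [MeasurableSpace 𝒵] (d : ℕ) where
  Θ : Set (Fin d → ℝ)
  μ : Measure 𝒵
  sigmaFinite : SigmaFinite μ
  p : (Fin d → ℝ) → 𝒵 → ℝ≥0
  measurable_p : Measurable fun x : Θ × 𝒵 => p x.1 x.2
  lintegral_p : ∀ θ ∈ Θ, ∫⁻ z, (p θ z : ℝ≥0∞) ∂μ = 1

section Defs

variable {𝒵 : Type*} [MeasurableSpace 𝒵] {d : ℕ}

/-- The distribution `P_θ`. -/
def Model.P (M : Model 𝒵 d) (θ : Fin d → ℝ) : Measure 𝒵 :=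
  M.μ.withDensity fun z => (M.p θ z : ℝ≥0∞)

/-- The log-likelihood ratio `log (p_θ' / p_θ)`, with values in `[-∞, ∞]`
(`-∞` where `p_θ' = 0`, and `∞` where `p_θ' > 0 = p_θ`). -/
def Model.logRatio (M : Model 𝒵 d) (θ' θ : Fin d → ℝ) (z : 𝒵) : EReal :=
  ENNReal.log ((M.p θ' z : ℝ≥0∞) / (M.p θ z : ℝ≥0∞))

/-- `θ₀` minimizes `θ ↦ KL(G ‖ P_θ)` over `Θ`. -/
def Model.IsKLProjection (M : Model 𝒵 d) (G : Measure 𝒵) (θ₀ : Fin d → ℝ) : Prop :=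
  θ₀ ∈ M.Θ ∧ ∀ θ ∈ M.Θ, InformationTheory.klDiv G (M.P θ₀) ≤ InformationTheory.klDiv G (M.P θ)

/-- The Fisher information `I_G = E_G[ℓ ℓᵀ]` of a score function `ℓ`. -/
def fisher (G : Measure 𝒵) (ℓ : 𝒵 → Fin d → ℝ) : Matrix (Fin d) (Fin d) ℝ :=
  Matrix.of fun i j => ∫ z, ℓ z i * ℓ z j ∂G

/-- The remainder `(p_{θ+h} / p_θ)^{1/2} - 1 - hᵀ ℓ / 2` of the expansion of the root density
ratio. -/
def Model.rootRemainder (M : Model 𝒵 d) (θ : Fin d → ℝ) (ℓ : 𝒵 → Fin d → ℝ) (h : Fin d → ℝ)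
    (z : 𝒵) : ℝ :=
  Real.sqrt (M.p (θ + h) z) / Real.sqrt (M.p θ z) - 1 - (1 / 2) * (h ⬝ᵥ ℓ z)

/-- Quadratic mean differentiability under misspecification, uniformly over `𝒢`, with score
functions `ℓ G`. -/
def IsQMD (M : Model 𝒵 d) (𝒢 : Set (ProbabilityMeasure 𝒵))
    (θ : ProbabilityMeasure 𝒵 → Fin d → ℝ) (ℓ : ProbabilityMeasure 𝒵 → 𝒵 → Fin d → ℝ)
    (δ : ℕ → ℝ≥0) : Prop :=
  (∀ G ∈ 𝒢, ∀ j, MemLp (fun z => ℓ G z j) 2 (G : Measure 𝒵)) ∧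
  ∃ φ : ProbabilityMeasure 𝒵 → ℝ≥0 → ℝ≥0,
    (∀ G ∈ 𝒢, IsModulus (φ G)) ∧
    (∀ n, ∀ G ∈ 𝒢, ∀ r ≤ δ n, ∀ h : Fin d → ℝ, scaledNorm (fisher (G : Measure 𝒵) (ℓ G)) h ≤ r →
      θ G + h ∈ M.Θ ∧
      ∫⁻ z, ENNReal.ofReal (M.rootRemainder (θ G) (ℓ G) h z ^ 2) ∂(G : Measure 𝒵) ≤ φ G r) ∧
    Tendsto (fun n => ⨆ G ∈ 𝒢, ⨆ r ∈ Set.Ioc 0 (δ n), ((φ G r / r ^ 2 : ℝ≥0) : ℝ≥0∞))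
      atTop (𝓝 0)

/-- Local quadratic expansion of `h ↦ E_G[log (p_{θ_G + h} / p_{θ_G})]`, uniformly over `𝒢`.
The expectation is required to exist and to be finite. -/
def HasHessian (M : Model 𝒵 d) (𝒢 : Set (ProbabilityMeasure 𝒵))
    (θ : ProbabilityMeasure 𝒵 → Fin d → ℝ)
    (V : ProbabilityMeasure 𝒵 → Matrix (Fin d) (Fin d) ℝ) (δ : ℕ → ℝ≥0) : Prop :=
  (∀ G ∈ 𝒢, (V G).PosDef) ∧
  ∃ ω : ProbabilityMeasure 𝒵 → ℝ≥0 → ℝ≥0,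
    (∀ G ∈ 𝒢, IsModulus (ω G)) ∧
    (∀ n, ∀ G ∈ 𝒢, ∀ r ≤ δ n, ∀ h : Fin d → ℝ, scaledNorm (V G) h ≤ r →
      θ G + h ∈ M.Θ ∧
      (∀ᵐ z ∂(G : Measure 𝒵),
        M.logRatio (θ G + h) (θ G) z ≠ ⊥ ∧ M.logRatio (θ G + h) (θ G) z ≠ ⊤) ∧
      Integrable (fun z => (M.logRatio (θ G + h) (θ G) z).toReal) (G : Measure 𝒵) ∧
      |∫ z, (M.logRatio (θ G + h) (θ G) z).toReal ∂(G : Measure 𝒵)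
        + (1 / 2) * (h ⬝ᵥ (V G).mulVec h)| ≤ ω G r) ∧
    Tendsto (fun n => ⨆ G ∈ 𝒢, ⨆ r ∈ Set.Ioc 0 (δ n), ((ω G r / r ^ 2 : ℝ≥0) : ℝ≥0∞))
      atTop (𝓝 0)

/-- Moment conditions with exponents `p ≥ 2` and `q = 2p/(p-2)` (so `q = ∞`, the essential
supremum, when `p = 2`), uniformly over `𝒢`. -/
def HasMoments (M : Model 𝒵 d) (𝒢 : Set (ProbabilityMeasure 𝒵))
    (θ : ProbabilityMeasure 𝒵 → Fin d → ℝ) (ℓ : ProbabilityMeasure 𝒵 → 𝒵 → Fin d → ℝ)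
    (δ : ℕ → ℝ≥0) (p : ℝ) (L : ℕ → ProbabilityMeasure 𝒵 → ℝ≥0) : Prop :=
  (∀ n, ∀ G ∈ 𝒢, ∀ r ≤ δ n, ∀ h : Fin d → ℝ, scaledNorm (fisher (G : Measure 𝒵) (ℓ G)) h ≤ r →
      θ G + h ∈ M.Θ ∧
      eLpNorm (M.rootRemainder (θ G) (ℓ G) h) (ENNReal.ofReal p) (G : Measure 𝒵)
        ≤ ((L n G * r : ℝ≥0) : ℝ≥0∞)) ∧
  ∃ ν : ProbabilityMeasure 𝒵 → ℝ≥0 → ℝ≥0,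
    (∀ G ∈ 𝒢, IsModulus (ν G)) ∧
    (∀ n, ∀ G ∈ 𝒢, ∀ r ≤ δ n, ∀ h : Fin d → ℝ, scaledNorm (fisher (G : Measure 𝒵) (ℓ G)) h ≤ r →
      eLpNorm (fun z => (M.logRatio (θ G + h) (θ G) z).abs)
        (ENNReal.ofReal (2 * p) / ENNReal.ofReal (p - 2)) (G : Measure 𝒵) ≤ ν G r) ∧
    Tendsto (fun n => ⨆ G ∈ 𝒢, ⨆ r ∈ Set.Iic (δ n), ((max (L n G) 1 * ν G r : ℝ≥0) : ℝ≥0∞))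
      atTop (𝓝 0)

/-- The uniform Lindeberg condition for the mean-zero, square integrable random vectors
`H G`, under `G ∈ 𝒢`. For `t` with `‖⟨t, H⟩‖₂ = 0` the expression is `0` by convention. -/
def IsULC (𝒢 : Set (ProbabilityMeasure 𝒵)) (H : ProbabilityMeasure 𝒵 → 𝒵 → Fin d → ℝ) : Prop :=
  (∀ G ∈ 𝒢, ∀ j, MemLp (fun z => H G z j) 2 (G : Measure 𝒵) ∧
    ∫ z, H G z j ∂(G : Measure 𝒵) = 0) ∧
  Tendsto (fun κ : ℝ => ⨆ G ∈ 𝒢, ⨆ t : Fin d → ℝ,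
      ∫⁻ z, ENNReal.ofReal
        ((t ⬝ᵥ H G z) ^ 2 / Real.sqrt (∫ y, (t ⬝ᵥ H G y) ^ 2 ∂(G : Measure 𝒵)) ^ 2 *
          min 1 (|t ⬝ᵥ H G z| / (κ * Real.sqrt (∫ y, (t ⬝ᵥ H G y) ^ 2 ∂(G : Measure 𝒵)))))
        ∂(G : Measure 𝒵))
    atTop (𝓝 0)

/-- Sample splitting with an initial estimator: for every `n`, a sample of size `N n`, disjoint
sets of indices `D₁ n`, `D₂ n` with `|D₂ n| = n`, and a measurable `Θ`-valued estimator that is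
computed from the observations in `D₁ n`. -/
structure SplitEstimator (M : Model 𝒵 d) where
  N : ℕ → ℕ
  D₁ : ∀ n, Finset (Fin (N n))
  D₂ : ∀ n, Finset (Fin (N n))
  disjoint : ∀ n, Disjoint (D₁ n) (D₂ n)
  card_D₂ : ∀ n, (D₂ n).card = n
  est : ∀ n, (D₁ n → 𝒵) → Fin d → ℝ
  measurable_est : ∀ n, Measurable (est n)
  est_mem : ∀ n z, est n z ∈ M.Θ

/-- The value of the initial estimator on the whole sample `Z` (it uses only `D₁ n`). -/
def SplitEstimator.val {M : Model 𝒵 d} (S : SplitEstimator M) (n : ℕ) (Z : Fin (S.N n) → 𝒵) :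
    Fin d → ℝ :=
  S.est n ((S.D₁ n).restrict Z)

/-- The joint distribution of `N` independent observations from `G`. -/
def iidLaw (G : ProbabilityMeasure 𝒵) (N : ℕ) : Measure (Fin N → 𝒵) :=
  Measure.pi fun _ => (G : Measure 𝒵)

/-- Consistency of the initial estimator. The maximum is formed in `[0, ∞]`, where
`‖h‖_V² / ‖h‖_I` is `0` for `h = 0` and `∞` for `‖h‖_I = 0 < ‖h‖_V`. -/
def IsConsistent {M : Model 𝒵 d} (S : SplitEstimator M) (𝒢 : Set (ProbabilityMeasure 𝒵))
    (θ : ProbabilityMeasure 𝒵 → Fin d → ℝ)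
    (I V : ProbabilityMeasure 𝒵 → Matrix (Fin d) (Fin d) ℝ) (δ : ℕ → ℝ≥0) : Prop :=
  limsup (fun n => ⨆ G ∈ 𝒢, iidLaw G (S.N n)
    {Z | (δ n : ℝ≥0∞) <
      max (ENNReal.ofReal (scaledNorm (I G) (S.val n Z - θ G)))
        (max (ENNReal.ofReal (scaledNorm (V G) (S.val n Z - θ G)))
          (ENNReal.ofReal (scaledNorm (V G) (S.val n Z - θ G) ^ 2) /
            ENNReal.ofReal (scaledNorm (I G) (S.val n Z - θ G))))}) atTop = 0

/-- The universal confidence set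
`{θ ∈ Θ : ∑_{i ∈ D₂} log (p_{θ̂₁}(Z_i) / p_θ(Z_i)) ≤ log (1/α)}`. -/
def universalCI {M : Model 𝒵 d} (S : SplitEstimator M) (α : ℝ) (n : ℕ)
    (Z : Fin (S.N n) → 𝒵) : Set (Fin d → ℝ) :=
  {θ | θ ∈ M.Θ ∧
    ∑ i ∈ S.D₂ n, M.logRatio (S.val n Z) θ (Z i) ≤ ((Real.log (1 / α) : ℝ) : EReal)}

/-- Asymptotic uniform extreme conservativeness of the confidence sets `CI n` (based on `N n`
independent observations) for `θ G`, over the class `𝒢`. -/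
def IsUniformlyExtremelyConservative (𝒢 : Set (ProbabilityMeasure 𝒵))
    (θ : ProbabilityMeasure 𝒵 → Fin d → ℝ) (N : ℕ → ℕ)
    (CI : ∀ n, (Fin (N n) → 𝒵) → Set (Fin d → ℝ)) : Prop :=
  limsup (fun n => ⨆ G ∈ 𝒢, iidLaw G (N n) {Z | θ G ∉ CI n Z}) atTop = 0

/-- Asymptotic uniform validity at level `α`; the subtraction in `[0, ∞]` is the positive part. -/
def IsUniformlyValid (𝒢 : Set (ProbabilityMeasure 𝒵))
    (θ : ProbabilityMeasure 𝒵 → Fin d → ℝ) (N : ℕ → ℕ)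
    (CI : ∀ n, (Fin (N n) → 𝒵) → Set (Fin d → ℝ)) (α : ℝ) : Prop :=
  limsup (fun n => ⨆ G ∈ 𝒢, (iidLaw G (N n) {Z | θ G ∉ CI n Z} - ENNReal.ofReal α)) atTop = 0

end Defs

end UnivInf

end

namespace UnivInf

/-! Write `h` for the displacement of the estimator from `θ G`, `s` and `v` for its norms in the
Fisher matrix and in `V G`, and `Y` for the log-likelihood ratio. The set misses `θ G` exactly when
the sum of `Y` over the second half exceeds `a = log (1/α) > 0`. Given the first half, the estimator
is a constant and the sum is i.i.d., so Chebyshev's inequality is enough once `‖Y‖₂ ≤ 20 s` and `E Y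
≤ -v²/4` are known. The level `a` lies at least `a + n v²/4` above the mean, and the variance is at
most `400 n s²`. Hence the probability is small if `√n s` is small (compare with `a`) or if `s / (√n
v²)` is small (compare with the drift `n v²/4`).

The drift bound is the quadratic expansion with its error absorbed. The second moment bound is the
main point: quadratic mean differentiability controls the root density ratio `x`, but not `log x`
near `x = 0`. There, `abs_two_mul_log_le` plays the remainder at `h` against the remainder at `4h`:
since `x₄ ≥ 0`, one of the two is bounded below, so `|Y|` is dominated by its product with that
remainder. Hölder's inequality and the moment condition bound the product
(`Model.eLpNorm_logRatio_le`). Fubini over the two halves (`SplitEstimator.iidLaw_le`) returns to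
the random estimator. -/

/-! ### Pointwise control of the logarithm. -/

theorem abs_two_mul_log_le {x x₄ a : ℝ} (hx : 0 < x) (hx₄ : 0 ≤ x₄) :
    |2 * Real.log x| ≤ 4 * |a| + 8 * |x - 1 - (1 / 2) * a|
      + 4 * |(x - 1 - (1 / 2) * a) * (2 * Real.log x)|
      + |(x₄ - 1 - (1 / 2) * (4 * a)) * (2 * Real.log x)| := by
  have hlog := Real.log_le_sub_one_of_pos hx
  have hlog' := Real.one_sub_inv_le_log_of_pos hx
  rw [abs_mul _ (2 * Real.log x), abs_mul _ (2 * Real.log x)]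
  set Y := 2 * Real.log x with hY
  set R := x - 1 - (1 / 2) * a with hR
  have hY0 := abs_nonneg Y
  have hx1 : |x - 1| ≤ |a| / 2 + |R| := by
    have : x - 1 = R + a / 2 := by rw [hR]; ring
    rw [this]
    calc |R + a / 2| ≤ |R| + |a / 2| := abs_add_le _ _
      _ = |a| / 2 + |R| := by rw [abs_div, abs_two]; ring
  have h1 : 0 ≤ |R| * |Y| := by positivity
  have h2 : 0 ≤ |x₄ - 1 - (1 / 2) * (4 * a)| * |Y| := by positivity
  have ha := abs_nonneg a
  have hRa := abs_nonneg R
  -- Away from zero the logarithm is Lipschitz, with constant at most 4, and the linear terms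
  -- suffice.
  by_cases hx4 : 1 / 4 ≤ x
  · have : |Y| ≤ 8 * |x - 1| := by
      rw [hY, abs_le]
      constructor
      · have hi : -(4 * |x - 1|) ≤ 1 - x⁻¹ := by
          have : 1 - x⁻¹ = (x - 1) * x⁻¹ := by field_simp
          rw [this]
          have hxi : x⁻¹ ≤ 4 := by
            rw [inv_le_comm₀ hx (by norm_num)]; linarith
          have hxi0 : 0 < x⁻¹ := inv_pos.mpr hx
          nlinarith [neg_abs_le (x - 1), abs_nonneg (x - 1)]
        linarith
      · linarith [le_abs_self (x - 1), abs_nonneg (x - 1)]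
    linarith
  · push Not at hx4
    -- A small `x` forces a large remainder. If `a ≤ -1`, the linearization at `4h` is `1 + 2a ≤ -1`
    -- while `x₄ ≥ 0`, so that remainder is at least 1. Otherwise the remainder at `h` is below `1/4
    -- - 1 + 1/2 = -1/4`.
    by_cases ha1 : a ≤ -1
    · have : 1 ≤ |x₄ - 1 - (1 / 2) * (4 * a)| := by
        rw [le_abs]; left; linarith
      nlinarith
    · push Not at ha1
      have : 1 / 4 ≤ |R| := by
        rw [le_abs]; right; rw [hR]; linarith
      nlinarith

theorem toReal_log_div {a b : ℝ≥0} (h₁ : ENNReal.log ((a : ℝ≥0∞) / b) ≠ ⊥)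
    (h₂ : ENNReal.log ((a : ℝ≥0∞) / b) ≠ ⊤) :
    0 < Real.sqrt a / Real.sqrt b ∧
      (ENNReal.log ((a : ℝ≥0∞) / b)).toReal = 2 * Real.log (Real.sqrt a / Real.sqrt b) := by
  have hdiv0 : (a : ℝ≥0∞) / b ≠ 0 := fun h => h₁ (ENNReal.log_eq_bot_iff.mpr h)
  have hdivT : (a : ℝ≥0∞) / b ≠ ⊤ := fun h => h₂ (ENNReal.log_eq_top_iff.mpr h)
  have ha : 0 < (a : ℝ) := by
    rw [NNReal.coe_pos, pos_iff_ne_zero]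
    rintro rfl
    simp at hdiv0
  have hb : 0 < (b : ℝ) := by
    rw [NNReal.coe_pos, pos_iff_ne_zero]
    rintro rfl
    apply hdivT
    rw [ENNReal.coe_zero, ENNReal.div_zero]
    simpa using ha.ne'
  refine ⟨by positivity, ?_⟩
  rw [ENNReal.log_pos_real hdiv0 hdivT, EReal.toReal_coe, ← Real.sqrt_div ha.le,
    Real.log_sqrt (by positivity)]
  simp only [ENNReal.toReal_div, ENNReal.coe_toReal]
  ring

/-! ### Second moments, scaled norms and Hölder exponents. -/

theorem eLpNorm_two_le_ofReal_iff {Ω : Type*} [MeasurableSpace Ω] {μ : Measure Ω} {f : Ω → ℝ}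
    {s : ℝ} (hs : 0 ≤ s) :
    eLpNorm f 2 μ ≤ ENNReal.ofReal s ↔
      ∫⁻ z, ENNReal.ofReal (f z ^ 2) ∂μ ≤ ENNReal.ofReal (s ^ 2) := by
  have h : eLpNorm f 2 μ ^ 2 = ∫⁻ z, ENNReal.ofReal (f z ^ 2) ∂μ := by
    have := eLpNorm_nnreal_pow_eq_lintegral (f := f) (μ := μ) (p := 2) (by norm_num)
    simp only [NNReal.coe_ofNat, ENNReal.coe_ofNat, ENNReal.rpow_ofNat] at this
    rw [this]
    refine lintegral_congr fun z => ?_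
    rw [Real.enorm_eq_ofReal_abs, ← ENNReal.ofReal_pow (abs_nonneg _), sq_abs]
  rw [← h, ENNReal.ofReal_pow hs]
  exact (ENNReal.pow_le_pow_left_iff (by norm_num)).symm

theorem scaledNorm_nonneg {d : ℕ} (A : Matrix (Fin d) (Fin d) ℝ) (x : Fin d → ℝ) :
    0 ≤ scaledNorm A x := Real.sqrt_nonneg _

theorem scaledNorm_smul {d : ℕ} (A : Matrix (Fin d) (Fin d) ℝ) {c : ℝ} (hc : 0 ≤ c)
    (x : Fin d → ℝ) : scaledNorm A (c • x) = c * scaledNorm A x := by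
  unfold scaledNorm
  rw [Matrix.mulVec_smul, smul_dotProduct, dotProduct_smul, smul_smul, smul_eq_mul,
    Real.sqrt_mul (mul_self_nonneg c), Real.sqrt_mul_self hc]

theorem continuous_scaledNorm {d : ℕ} (A : Matrix (Fin d) (Fin d) ℝ) :
    Continuous (scaledNorm A) := by
  unfold scaledNorm
  fun_prop

theorem measurable_scaledNorm {d : ℕ} (A : Matrix (Fin d) (Fin d) ℝ) :
    Measurable (scaledNorm A) := (continuous_scaledNorm A).measurable

theorem scaledNorm_sq {d : ℕ} {A : Matrix (Fin d) (Fin d) ℝ} (hA : A.PosDef) (x : Fin d → ℝ) :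
    scaledNorm A x ^ 2 = x ⬝ᵥ A.mulVec x := by
  unfold scaledNorm
  rw [Real.sq_sqrt]
  simpa using hA.posSemidef.dotProduct_mulVec_nonneg x

theorem eq_zero_of_scaledNorm_eq_zero {d : ℕ} {A : Matrix (Fin d) (Fin d) ℝ} (hA : A.PosDef)
    {x : Fin d → ℝ} (hx : scaledNorm A x = 0) : x = 0 := by
  by_contra h
  have h1 := hA.dotProduct_mulVec_pos h
  have h2 := scaledNorm_sq hA x
  rw [hx] at h2
  simp only [star_trivial] at h1
  simp at h2
  linarith

theorem memLp_dotProduct {𝒵 : Type*} [MeasurableSpace 𝒵] {d : ℕ} {G : Measure 𝒵}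
    {ℓ : 𝒵 → Fin d → ℝ} (hℓ : ∀ j, MemLp (fun z => ℓ z j) 2 G) (h : Fin d → ℝ) :
    MemLp (fun z => h ⬝ᵥ ℓ z) 2 G := by
  unfold dotProduct
  exact memLp_finsetSum _ fun j _ => (hℓ j).const_mul (h j)

theorem scaledNorm_fisher_sq {𝒵 : Type*} [MeasurableSpace 𝒵] {d : ℕ} {G : Measure 𝒵}
    {ℓ : 𝒵 → Fin d → ℝ} (hℓ : ∀ j, MemLp (fun z => ℓ z j) 2 G) (h : Fin d → ℝ) :
    scaledNorm (fisher G ℓ) h ^ 2 = ∫ z, (h ⬝ᵥ ℓ z) ^ 2 ∂G := by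
  have key : h ⬝ᵥ (fisher G ℓ).mulVec h = ∫ z, (h ⬝ᵥ ℓ z) ^ 2 ∂G := by
    have hint : ∀ i j, Integrable (fun z => h i * (ℓ z i * ℓ z j * h j)) G := fun i j =>
      (((hℓ i).integrable_mul (hℓ j)).mul_const _).const_mul _
    have : ∀ z, (h ⬝ᵥ ℓ z) ^ 2 = ∑ i, ∑ j, h i * (ℓ z i * ℓ z j * h j) := fun z => by
      rw [sq]
      simp only [dotProduct]
      rw [Finset.sum_mul_sum]
      exact Finset.sum_congr rfl fun i _ => Finset.sum_congr rfl fun j _ => by ring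
    simp_rw [this]
    rw [integral_finsetSum _ fun i _ => integrable_finsetSum _ fun j _ => hint i j]
    simp only [dotProduct, Matrix.mulVec, fisher, Matrix.of_apply, Finset.mul_sum]
    refine Finset.sum_congr rfl fun i _ => ?_
    rw [integral_finsetSum _ fun j _ => hint i j]
    refine Finset.sum_congr rfl fun j _ => ?_
    rw [integral_const_mul, integral_mul_const]
  unfold scaledNorm
  rw [key, Real.sq_sqrt (integral_nonneg fun z => sq_nonneg _)]

theorem eLpNorm_dotProduct {𝒵 : Type*} [MeasurableSpace 𝒵] {d : ℕ} {G : Measure 𝒵}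
    {ℓ : 𝒵 → Fin d → ℝ} (hℓ : ∀ j, MemLp (fun z => ℓ z j) 2 G) (h : Fin d → ℝ) :
    eLpNorm (fun z => h ⬝ᵥ ℓ z) 2 G ≤ ENNReal.ofReal (scaledNorm (fisher G ℓ) h) := by
  rw [eLpNorm_two_le_ofReal_iff (scaledNorm_nonneg _ _), scaledNorm_fisher_sq hℓ,
    ofReal_integral_eq_lintegral_ofReal (memLp_dotProduct hℓ h).integrable_sq
      (ae_of_all _ fun z => sq_nonneg _)]

theorem holderTriple_ofReal {p : ℝ} (hp : 2 ≤ p) :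
    ENNReal.HolderTriple (ENNReal.ofReal p) (ENNReal.ofReal (2 * p) / ENNReal.ofReal (p - 2)) 2 := by
  constructor
  rcases hp.eq_or_lt with rfl | hp
  -- For `p = 2` the second exponent is `4 / 0 = ∞`, whose inverse is 0.
  · simp [ENNReal.div_zero]
  · have h2 : (2 : ℝ≥0∞) = ENNReal.ofReal 2 := by simp
    rw [ENNReal.inv_div (Or.inr ENNReal.ofReal_ne_top) (Or.inr (by simp; linarith)), ← ENNReal.ofReal_inv_of_pos (by linarith),
      ← ENNReal.ofReal_div_of_pos (by linarith), ← ENNReal.ofReal_add (by positivity)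
        (div_nonneg (by linarith) (by linarith)), h2, ← ENNReal.ofReal_inv_of_pos (by norm_num)]
    congr 1
    field_simp
    ring

/-! ### The second moment of the log-likelihood ratio. -/

variable {𝒵 : Type*} [MeasurableSpace 𝒵] {d : ℕ}

theorem Model.measurable_density (M : Model 𝒵 d) {θ : Fin d → ℝ} (hθ : θ ∈ M.Θ) :
    Measurable (M.p θ) :=
  M.measurable_p.comp (measurable_const.prodMk measurable_id : Measurable fun z => ((⟨θ, hθ⟩ : M.Θ), z))

theorem Model.measurable_logRatio (M : Model 𝒵 d) {θ θ' : Fin d → ℝ} (hθ : θ ∈ M.Θ)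
    (hθ' : θ' ∈ M.Θ) : Measurable (M.logRatio θ' θ) :=
  ENNReal.measurable_log.comp ((M.measurable_density hθ').coe_nnreal_ennreal.div
    (M.measurable_density hθ).coe_nnreal_ennreal)

theorem Model.aestronglyMeasurable_rootRemainder (M : Model 𝒵 d) {G : Measure 𝒵}
    {ℓ : 𝒵 → Fin d → ℝ} (hℓ : ∀ j, MemLp (fun z => ℓ z j) 2 G) {θ h : Fin d → ℝ}
    (hθ : θ ∈ M.Θ) (hθ' : θ + h ∈ M.Θ) :
    AEStronglyMeasurable (M.rootRemainder θ ℓ h) G := by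
  have h₁ := (M.measurable_density hθ).coe_nnreal_real.sqrt
  have h₂ := (M.measurable_density hθ').coe_nnreal_real.sqrt
  have h₃ := (memLp_dotProduct hℓ h).aestronglyMeasurable
  exact (((h₂.div h₁).sub measurable_const).aestronglyMeasurable.sub (h₃.const_mul _))

theorem enorm_toReal_eq_abs {x : EReal} (h₁ : x ≠ ⊥) (h₂ : x ≠ ⊤) : ‖x.toReal‖ₑ = x.abs := by
  lift x to ℝ using ⟨h₂, h₁⟩
  rw [EReal.toReal_coe, EReal.abs_def, Real.enorm_eq_ofReal_abs]

/-- Take `L²` norms in `abs_two_mul_log_le`. The score and the remainder have norm at most `s`. By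
Hölder with `1/p + 1/q = 1/2` and `L * ν ≤ 1`, the products with the remainders at `h` and `4h` have
norms at most `s` and `4s`. The constant is `4 + 8 + 4 + 4 = 20`. -/
theorem Model.eLpNorm_logRatio_le (M : Model 𝒵 d) {G : Measure 𝒵}
    {ℓ : 𝒵 → Fin d → ℝ} (hℓ : ∀ j, MemLp (fun z => ℓ z j) 2 G) {θ h : Fin d → ℝ} {p : ℝ}
    (hp : 2 ≤ p) {s L ν : ℝ≥0} (hs : scaledNorm (fisher G ℓ) h = s)
    (hθ : θ ∈ M.Θ) (hθ' : θ + h ∈ M.Θ) (hθ₄ : θ + (4 : ℝ) • h ∈ M.Θ)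
    (hfin : ∀ᵐ z ∂G, M.logRatio (θ + h) θ z ≠ ⊥ ∧ M.logRatio (θ + h) θ z ≠ ⊤)
    (hR : eLpNorm (M.rootRemainder θ ℓ h) 2 G ≤ s)
    (hRp : eLpNorm (M.rootRemainder θ ℓ h) (ENNReal.ofReal p) G ≤ ((L * s : ℝ≥0) : ℝ≥0∞))
    (hR₄ : eLpNorm (M.rootRemainder θ ℓ ((4 : ℝ) • h)) (ENNReal.ofReal p) G
      ≤ ((L * (4 * s) : ℝ≥0) : ℝ≥0∞))
    (hν : eLpNorm (fun z => (M.logRatio (θ + h) θ z).abs)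
      (ENNReal.ofReal (2 * p) / ENNReal.ofReal (p - 2)) G ≤ ν)
    (hLν : L * ν ≤ 1) :
    eLpNorm (fun z => (M.logRatio (θ + h) θ z).toReal) 2 G ≤ ((20 * s : ℝ≥0) : ℝ≥0∞) := by
  set Y : 𝒵 → ℝ := fun z => (M.logRatio (θ + h) θ z).toReal with hY
  set R := M.rootRemainder θ ℓ h with hRdef
  set R₄ := M.rootRemainder θ ℓ ((4 : ℝ) • h) with hR₄def
  set A : 𝒵 → ℝ := fun z => h ⬝ᵥ ℓ z with hAdef
  have hYm : AEStronglyMeasurable Y G :=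
    (M.measurable_logRatio hθ hθ').ereal_toReal.aestronglyMeasurable
  have hRm : AEStronglyMeasurable R G := M.aestronglyMeasurable_rootRemainder hℓ hθ hθ'
  have hR₄m : AEStronglyMeasurable R₄ G := M.aestronglyMeasurable_rootRemainder hℓ hθ hθ₄
  have hAm : AEStronglyMeasurable A G := (memLp_dotProduct hℓ h).aestronglyMeasurable
  have hA : eLpNorm A 2 G ≤ s := by
    have := eLpNorm_dotProduct hℓ h
    rwa [hs, ENNReal.ofReal_coe_nnreal] at this
  have hνY : eLpNorm Y (ENNReal.ofReal (2 * p) / ENNReal.ofReal (p - 2)) G ≤ ν := by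
    refine le_of_eq_of_le (eLpNorm_congr_enorm_ae ?_) hν
    filter_upwards [hfin] with z hz
    rw [enorm_toReal_eq_abs hz.1 hz.2, enorm_eq_self]
  have holder : ∀ (f : 𝒵 → ℝ) (t : ℝ≥0), AEStronglyMeasurable f G →
      eLpNorm f (ENNReal.ofReal p) G ≤ ((L * t : ℝ≥0) : ℝ≥0∞) →
      eLpNorm (fun z => f z * Y z) 2 G ≤ t := by
    intro f t hf hft
    have := holderTriple_ofReal hp
    have := eLpNorm_smul_le_mul_eLpNorm (p := ENNReal.ofReal p)
      (q := ENNReal.ofReal (2 * p) / ENNReal.ofReal (p - 2)) (r := 2) hYm hf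
    calc eLpNorm (fun z => f z * Y z) 2 G ≤ _ := this
      _ ≤ ((L * t : ℝ≥0) : ℝ≥0∞) * ν := mul_le_mul' hft hνY
      _ = ((L * ν * t : ℝ≥0) : ℝ≥0∞) := by push_cast; ring
      _ ≤ t := by
        rw [ENNReal.coe_le_coe]
        exact mul_le_of_le_one_left (zero_le) hLν
  have hRY := holder R s hRm hRp
  have hR₄Y := holder R₄ (4 * s) hR₄m hR₄
  have hpt : ∀ᵐ z ∂G, ‖Y z‖ ≤
      ((4 : ℝ) • fun z => |A z|) z + ((8 : ℝ) • fun z => |R z|) z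
        + ((4 : ℝ) • fun z => |R z * Y z|) z + |R₄ z * Y z| := by
    filter_upwards [hfin] with z hz
    obtain ⟨hx, hlog⟩ := toReal_log_div hz.1 hz.2
    have hx₄ : 0 ≤ √(M.p (θ + (4 : ℝ) • h) z : ℝ) / √(M.p θ z : ℝ) := by positivity
    have key := abs_two_mul_log_le (a := h ⬝ᵥ ℓ z) hx hx₄
    have hYz : Y z = 2 * Real.log (√(M.p (θ + h) z : ℝ) / √(M.p θ z : ℝ)) := hlog
    rw [← hYz] at key
    simp only [Pi.smul_apply, smul_eq_mul, Real.norm_eq_abs, hRdef, hR₄def, hAdef,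
      Model.rootRemainder, smul_dotProduct]
    exact key
  have abs_norm : ∀ f : 𝒵 → ℝ, eLpNorm (fun z => |f z|) 2 G = eLpNorm f 2 G :=
    fun f => eLpNorm_norm f
  have hm : ∀ (c : ℝ) {f : 𝒵 → ℝ}, AEStronglyMeasurable f G →
      AEStronglyMeasurable (c • fun z => |f z|) G := fun c f hf => hf.norm.const_smul c
  have hn : ∀ (c : ℝ≥0) {f : 𝒵 → ℝ} {t : ℝ≥0}, eLpNorm f 2 G ≤ t →
      eLpNorm ((c : ℝ) • fun z => |f z|) 2 G ≤ ((c * t : ℝ≥0) : ℝ≥0∞) := by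
    intro c f t hf
    rw [eLpNorm_const_smul, abs_norm, Real.enorm_eq_ofReal c.coe_nonneg, ENNReal.ofReal_coe_nnreal,
      ENNReal.coe_mul]
    gcongr
  have hRYm : AEStronglyMeasurable (fun z => R z * Y z) G := hRm.mul hYm
  have hR₄Ym : AEStronglyMeasurable (fun z => R₄ z * Y z) G := hR₄m.mul hYm
  have one_le : (1 : ℝ≥0∞) ≤ 2 := by norm_num
  calc eLpNorm Y 2 G ≤ _ := eLpNorm_mono_ae_real hpt
    _ ≤ eLpNorm ((4 : ℝ) • fun z => |A z|) 2 G + eLpNorm ((8 : ℝ) • fun z => |R z|) 2 G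
        + eLpNorm ((4 : ℝ) • fun z => |R z * Y z|) 2 G + eLpNorm (fun z => |R₄ z * Y z|) 2 G := by
      refine (eLpNorm_add_le (((hm 4 hAm).add (hm 8 hRm)).add (hm 4 hRYm)) hR₄Ym.norm one_le).trans ?_
      gcongr
      refine (eLpNorm_add_le ((hm 4 hAm).add (hm 8 hRm)) (hm 4 hRYm) one_le).trans ?_
      gcongr
      · exact eLpNorm_add_le (hm 4 hAm) (hm 8 hRm) one_le
      · exact le_rfl
    _ ≤ ((4 * s : ℝ≥0) : ℝ≥0∞) + ((8 * s : ℝ≥0) : ℝ≥0∞) + ((4 * s : ℝ≥0) : ℝ≥0∞)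
        + ((4 * s : ℝ≥0) : ℝ≥0∞) := by
      rw [abs_norm]
      gcongr
      · exact hn 4 hA
      · exact hn 8 hR
      · exact hn 4 hRY
    _ = _ := by
      rw [← ENNReal.coe_add, ← ENNReal.coe_add, ← ENNReal.coe_add]
      congr 1
      ring

/-! ### Chebyshev's inequality for i.i.d. sums. -/

/-- Here `c` is any positive lower bound for the gap between the level `a` and the mean of the sum;
leaving it free allows either part of the gap to be used alone. -/
theorem iidLaw_sum_gt_le (G : ProbabilityMeasure 𝒵) {N : ℕ} (D : Finset (Fin N)) {Y : 𝒵 → ℝ}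
    (hYm : AEStronglyMeasurable Y (G : Measure 𝒵)) {σ : ℝ≥0}
    (hσ : eLpNorm Y 2 (G : Measure 𝒵) ≤ σ) {a c : ℝ} (hc : 0 < c)
    (hac : c + D.card * ∫ z, Y z ∂(G : Measure 𝒵) ≤ a) :
    iidLaw G N {Z | a < ∑ i ∈ D, Y (Z i)} ≤ ENNReal.ofReal (D.card * σ ^ 2 / c ^ 2) := by
  have hprob : IsProbabilityMeasure (iidLaw G N) := by unfold iidLaw; infer_instance
  have hY : MemLp Y 2 (G : Measure 𝒵) := ⟨hYm, hσ.trans_lt ENNReal.coe_lt_top⟩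
  have hmp : ∀ i : Fin N, MeasurePreserving (fun Z : Fin N → 𝒵 => Z i) (iidLaw G N)
      (G : Measure 𝒵) := fun i => measurePreserving_eval (fun _ => (G : Measure 𝒵)) i
  set X : Fin N → (Fin N → 𝒵) → ℝ := fun i Z => Y (Z i) with hX
  have hXL : ∀ i, MemLp (X i) 2 (iidLaw G N) := fun i => hY.comp_measurePreserving (hmp i)
  have hmean : ∫ Z, (∑ i ∈ D, X i) Z ∂(iidLaw G N) = D.card * ∫ z, Y z ∂(G : Measure 𝒵) := by
    simp_rw [Finset.sum_apply]
    rw [integral_finsetSum _ fun i _ => (hXL i).integrable (by norm_num)]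
    have : ∀ i, ∫ Z, X i Z ∂(iidLaw G N) = ∫ z, Y z ∂(G : Measure 𝒵) := fun i => by
      rw [← (hmp i).map_eq, integral_map (hmp i).measurable.aemeasurable]
      rw [(hmp i).map_eq]
      exact hYm
    simp [this]
  have hvarY : ProbabilityTheory.variance Y (G : Measure 𝒵) ≤ σ ^ 2 := by
    refine (ProbabilityTheory.variance_le_expectation_sq hYm).trans ?_
    have h1 := (eLpNorm_two_le_ofReal_iff (f := Y) (μ := (G : Measure 𝒵)) σ.2).mp
      (by simpa using hσ)
    rw [← ofReal_integral_eq_lintegral_ofReal hY.integrable_sq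
      (ae_of_all _ fun z => sq_nonneg _)] at h1
    exact (ENNReal.ofReal_le_ofReal_iff (by positivity)).mp h1
  have hind : ProbabilityTheory.iIndepFun X (iidLaw G N) :=
    ProbabilityTheory.iIndepFun_pi (μ := fun _ : Fin N => (G : Measure 𝒵)) (X := fun _ => Y)
      fun _ => hYm.aemeasurable
  have hvar : ProbabilityTheory.variance (∑ i ∈ D, X i) (iidLaw G N) ≤ D.card * σ ^ 2 := by
    rw [ProbabilityTheory.IndepFun.variance_sum (fun i _ => hXL i)
      (fun i _ j _ hij => hind.indepFun hij), ← nsmul_eq_mul]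
    refine Finset.sum_le_card_nsmul _ _ _ fun i _ => ?_
    refine le_trans (le_of_eq ?_) hvarY
    have hYm' : AEMeasurable Y ((iidLaw G N).map fun Z => Z i) := by
      rw [(hmp i).map_eq]; exact hYm.aemeasurable
    have := ProbabilityTheory.variance_map hYm' (hmp i).measurable.aemeasurable
    rw [(hmp i).map_eq] at this
    exact this.symm
  have hsum : MemLp (∑ i ∈ D, X i) 2 (iidLaw G N) := memLp_finsetSum' _ fun i _ => hXL i
  calc iidLaw G N {Z | a < ∑ i ∈ D, Y (Z i)}
      ≤ iidLaw G N {Z | c ≤ |(∑ i ∈ D, X i) Z - ∫ Z, (∑ i ∈ D, X i) Z ∂(iidLaw G N)|} := by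
        refine measure_mono fun Z hZ => ?_
        rw [Set.mem_ofPred_eq] at hZ ⊢
        rw [hmean, Finset.sum_apply]
        refine le_trans ?_ (le_abs_self _)
        linarith
    _ ≤ _ := ProbabilityTheory.meas_ge_le_variance_div_sq hsum hc
    _ ≤ _ := ENNReal.ofReal_le_ofReal (by gcongr)

theorem coe_finsetSum_toReal {ι : Type*} (D : Finset ι) {x : ι → EReal}
    (hx : ∀ i ∈ D, x i ≠ ⊥ ∧ x i ≠ ⊤) :
    ∑ i ∈ D, x i = ((∑ i ∈ D, (x i).toReal : ℝ) : EReal) := by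
  induction D using Finset.cons_induction with
  | empty => simp
  | cons i D hi ih =>
    rw [Finset.sum_cons, Finset.sum_cons, ih fun j hj => hx j (Finset.mem_cons_of_mem hj),
      EReal.coe_add, EReal.coe_toReal (hx i (Finset.mem_cons_self i D)).2
        (hx i (Finset.mem_cons_self i D)).1]

theorem iidLaw_sum_ereal_gt_le (G : ProbabilityMeasure 𝒵) {N : ℕ} (D : Finset (Fin N))
    {Y : 𝒵 → EReal} (hfin : ∀ᵐ z ∂(G : Measure 𝒵), Y z ≠ ⊥ ∧ Y z ≠ ⊤) (a : ℝ) :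
    iidLaw G N {Z | (a : EReal) < ∑ i ∈ D, Y (Z i)} ≤
      iidLaw G N {Z | a < ∑ i ∈ D, (Y (Z i)).toReal} := by
  refine measure_mono_ae ?_
  have hmp : ∀ i : Fin N, MeasurePreserving (fun Z : Fin N → 𝒵 => Z i) (iidLaw G N)
      (G : Measure 𝒵) := fun i => measurePreserving_eval (fun _ => (G : Measure 𝒵)) i
  have := ae_all_iff.mpr fun i => (hmp i).quasiMeasurePreserving.ae hfin
  filter_upwards [this] with Z hZ hlt
  have hlt' : (a : EReal) < ∑ i ∈ D, Y (Z i) := hlt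
  rw [coe_finsetSum_toReal D fun i _ => hZ i, EReal.coe_lt_coe_iff] at hlt'
  exact hlt'

/-! ### Bounds uniform over the class. -/

theorem IsModulus.map_zero {ω : ℝ≥0 → ℝ≥0} (hω : IsModulus ω) : ω 0 = 0 :=
  eq_of_tendsto_nhds hω.2

theorem eventually_forall_le_of_tendsto_biSup {ι : Type*} {𝒢 : Set ι} {s : ℕ → Set ℝ≥0}
    {f : ℕ → ι → ℝ≥0 → ℝ≥0}
    (hf : Tendsto (fun n => ⨆ G ∈ 𝒢, ⨆ r ∈ s n, ((f n G r : ℝ≥0) : ℝ≥0∞)) atTop (𝓝 0))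
    {c : ℝ≥0} (hc : 0 < c) : ∀ᶠ n in atTop, ∀ G ∈ 𝒢, ∀ r ∈ s n, f n G r ≤ c := by
  filter_upwards [hf.eventually_lt_const (ENNReal.coe_pos.mpr hc)] with n hn G hG r hr
  rw [← ENNReal.coe_le_coe]
  refine le_trans ?_ hn.le
  exact (le_iSup₂ (f := fun r (_ : r ∈ s n) => ((f n G r : ℝ≥0) : ℝ≥0∞)) r hr).trans
    (le_iSup₂ (f := fun G (_ : G ∈ 𝒢) => ⨆ r ∈ s n, ((f n G r : ℝ≥0) : ℝ≥0∞)) G hG)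

theorem eventually_modulus_le_mul_sq {ι : Type*} {𝒢 : Set ι} {δ : ℕ → ℝ≥0} {φ : ι → ℝ≥0 → ℝ≥0}
    (hφ : ∀ G ∈ 𝒢, IsModulus (φ G))
    (h : Tendsto (fun n => ⨆ G ∈ 𝒢, ⨆ r ∈ Set.Ioc 0 (δ n), ((φ G r / r ^ 2 : ℝ≥0) : ℝ≥0∞))
      atTop (𝓝 0)) {c : ℝ≥0} (hc : 0 < c) :
    ∀ᶠ n in atTop, ∀ G ∈ 𝒢, ∀ r ≤ δ n, φ G r ≤ c * r ^ 2 := by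
  filter_upwards [eventually_forall_le_of_tendsto_biSup (f := fun _ G r => φ G r / r ^ 2) h hc]
    with n hn G hG r hr
  rcases eq_zero_or_pos r with rfl | h0
  · simp [(hφ G hG).map_zero]
  · exact (div_le_iff₀ (by positivity)).mp (hn G hG r ⟨h0, hr⟩)

/-- Finiteness, a second moment bound and a drift bound for the log-likelihood ratio of `θ'`
against `θ`, in terms of the distance of the two parameters. -/
structure Model.HasLogRatioBounds (M : Model 𝒵 d) (G : Measure 𝒵) (θ' θ : Fin d → ℝ)
    (s v : ℝ) : Prop where
  ae_finite : ∀ᵐ z ∂G, M.logRatio θ' θ z ≠ ⊥ ∧ M.logRatio θ' θ z ≠ ⊤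
  eLpNorm_le : eLpNorm (fun z => (M.logRatio θ' θ z).toReal) 2 G ≤ ENNReal.ofReal (20 * s)
  integral_le : ∫ z, (M.logRatio θ' θ z).toReal ∂G ≤ -(v ^ 2 / 4)

/-- The factor 4 keeps `4h` within the radius of the moment condition. The index `k` is chosen so
that the squared remainder is at most `s²`, the product of `L` and `ν` at most 1, and the Hessian
error at most `v²/4`, which leaves half of the drift `-v²/2`. -/
theorem eventually_hasLogRatioBounds {M : Model 𝒵 d} {𝒢 : Set (ProbabilityMeasure 𝒵)}
    {θ : ProbabilityMeasure 𝒵 → Fin d → ℝ} (hθ : ∀ G ∈ 𝒢, θ G ∈ M.Θ)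
    {ℓ : ProbabilityMeasure 𝒵 → 𝒵 → Fin d → ℝ}
    {V : ProbabilityMeasure 𝒵 → Matrix (Fin d) (Fin d) ℝ} {δ : ℕ → ℝ≥0} {p : ℝ} (hp : 2 ≤ p)
    {L : ℕ → ProbabilityMeasure 𝒵 → ℝ≥0} (hQMD : IsQMD M 𝒢 θ ℓ δ) (hHess : HasHessian M 𝒢 θ V δ)
    (hMom : HasMoments M 𝒢 θ ℓ δ p L) :
    ∀ᶠ k in atTop, ∀ G ∈ 𝒢, ∀ h : Fin d → ℝ,
      4 * scaledNorm (fisher (G : Measure 𝒵) (ℓ G)) h ≤ δ k → scaledNorm (V G) h ≤ δ k →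
      M.HasLogRatioBounds (G : Measure 𝒵) (θ G + h) (θ G)
        (scaledNorm (fisher (G : Measure 𝒵) (ℓ G)) h) (scaledNorm (V G) h) := by
  obtain ⟨hℓ, φ, hφ, hR, hφ0⟩ := hQMD
  obtain ⟨hV, ω, hω, hE, hω0⟩ := hHess
  obtain ⟨hRp, ν, hν, hY, hν0⟩ := hMom
  filter_upwards [eventually_modulus_le_mul_sq hφ hφ0 one_pos,
    eventually_modulus_le_mul_sq hω hω0 (c := 1 / 4) (by norm_num),
    eventually_forall_le_of_tendsto_biSup (f := fun n G r => max (L n G) 1 * ν G r) hν0 one_pos]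
    with k hφk hωk hνk G hG h hs hv
  have hs0 := scaledNorm_nonneg (fisher (G : Measure 𝒵) (ℓ G)) h
  have hv0 := scaledNorm_nonneg (V G) h
  obtain ⟨s, hs_eq⟩ : ∃ s : ℝ≥0, scaledNorm (fisher (G : Measure 𝒵) (ℓ G)) h = s := ⟨⟨_, hs0⟩, rfl⟩
  obtain ⟨v, hv_eq⟩ : ∃ v : ℝ≥0, scaledNorm (V G) h = v := ⟨⟨_, hv0⟩, rfl⟩
  have h4 := scaledNorm_smul (fisher (G : Measure 𝒵) (ℓ G)) (c := 4) (by norm_num) h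
  rw [hs_eq] at hs h4
  rw [hv_eq] at hv
  have h4s : 4 * s ≤ δ k := by exact_mod_cast hs
  have hsk : s ≤ δ k := le_trans (le_mul_of_one_le_left (zero_le) (by norm_num)) h4s
  have hvk : v ≤ δ k := by exact_mod_cast hv
  obtain ⟨hmem, hR2⟩ := hR k G hG s hsk h hs_eq.le
  obtain ⟨hmem4, hRp4⟩ := hRp k G hG (4 * s) h4s ((4 : ℝ) • h) (by rw [h4]; norm_cast)
  obtain ⟨-, hfin, -, hint⟩ := hE k G hG v hvk h hv_eq.le
  rw [hs_eq, hv_eq]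
  refine ⟨hfin, ?_, ?_⟩
  · have hLν : L k G * ν G s ≤ 1 :=
      (mul_le_mul_left (le_max_left _ _) _).trans (hνk G hG s hsk)
    have := M.eLpNorm_logRatio_le (hℓ G hG) hp hs_eq (hθ G hG) hmem hmem4 hfin ?_
      (hRp k G hG s hsk h hs_eq.le).2 hRp4 (hY k G hG s hsk h hs_eq.le) hLν
    · refine this.trans_eq ?_
      rw [← ENNReal.ofReal_coe_nnreal]
      push_cast
      rfl
    · have h2 := (eLpNorm_two_le_ofReal_iff (f := M.rootRemainder (θ G) (ℓ G) h)
        (μ := (G : Measure 𝒵)) s.coe_nonneg).mpr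
      rw [ENNReal.ofReal_coe_nnreal] at h2
      refine h2 (hR2.trans ?_)
      rw [← NNReal.coe_pow, ENNReal.ofReal_coe_nnreal, ENNReal.coe_le_coe]
      simpa using hφk G hG s hsk
  · have hωv : (ω G v : ℝ) ≤ 1 / 4 * (v : ℝ) ^ 2 := by exact_mod_cast hωk G hG v hvk
    have h1 := scaledNorm_sq (hV G hG) h
    rw [hv_eq] at h1
    rw [← h1] at hint
    have := (abs_le.mp hint).2
    linarith

/-! ### Tail bound for a fixed parameter, and sample splitting. -/

theorem iidLaw_logRatio_gt_le {M : Model 𝒵 d} (G : ProbabilityMeasure 𝒵) {N : ℕ}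
    {D : Finset (Fin N)} (hD : 0 < D.card) {θ θ' : Fin d → ℝ} (hθ : θ ∈ M.Θ) (hθ' : θ' ∈ M.Θ)
    {s v : ℝ} (hs : 0 ≤ s) (hv : 0 ≤ v) (hsv : v = 0 → s = 0)
    (hM : M.HasLogRatioBounds (G : Measure 𝒵) θ' θ s v) {a ε : ℝ} (ha : 0 < a) (hε : 0 ≤ ε)
    (hmin : min (√D.card * s) (s / (√D.card * v ^ 2)) ≤ ε) :
    iidLaw G N {Z | (a : EReal) < ∑ i ∈ D, M.logRatio θ' θ (Z i)} ≤
      ENNReal.ofReal (400 * ε ^ 2 * (1 / a ^ 2 + 16)) := by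
  refine (iidLaw_sum_ereal_gt_le G D hM.ae_finite a).trans ?_
  have hn : (0 : ℝ) < D.card := by exact_mod_cast hD
  have hsq : √(D.card : ℝ) ^ 2 = D.card := Real.sq_sqrt hn.le
  have hσ : ((20 * s.toNNReal : ℝ≥0) : ℝ) = 20 * s := by
    rw [NNReal.coe_mul, Real.coe_toNNReal s hs]; rfl
  have tail : ∀ c : ℝ, 0 < c → c ≤ a + D.card * (v ^ 2 / 4) → _ := fun c hc hca =>
    iidLaw_sum_gt_le G D (M.measurable_logRatio hθ hθ').ereal_toReal.aestronglyMeasurable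
      (σ := 20 * s.toNNReal) (a := a) (c := c)
      (hM.eLpNorm_le.trans_eq (by rw [← hσ, ENNReal.ofReal_coe_nnreal])) hc (by
        have := mul_le_mul_of_nonneg_left hM.integral_le hn.le
        linarith)
  rw [hσ] at tail
  have small : √D.card * s ≤ ε → iidLaw G N {Z | a < ∑ i ∈ D, (M.logRatio θ' θ (Z i)).toReal} ≤
      ENNReal.ofReal (400 * ε ^ 2 * (1 / a ^ 2 + 16)) := by
    intro h
    refine (tail a ha (le_add_of_nonneg_right (by positivity))).trans (ENNReal.ofReal_le_ofReal ?_)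
    have h2 : D.card * s ^ 2 ≤ ε ^ 2 := by
      rw [← hsq, ← mul_pow]
      exact pow_le_pow_left₀ (by positivity) h 2
    calc D.card * (20 * s) ^ 2 / a ^ 2 = 400 * (D.card * s ^ 2) * (1 / a ^ 2) := by ring
      _ ≤ 400 * ε ^ 2 * (1 / a ^ 2 + 16) := by gcongr; linarith
  -- At `v = 0` the second entry of the minimum is `s / 0 = 0` and carries no information; `s = 0`
  -- then puts the first entry to use.
  rcases hv.eq_or_lt with h0 | hv0
  · refine small ?_
    rw [hsv h0.symm, mul_zero]
    exact hε
  rcases min_le_iff.mp hmin with h | h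
  · exact small h
  -- The drift alone serves as the gap; its factor `1/4`, squared, gives the 16.
  · have hc : 0 < D.card * (v ^ 2 / 4) := by positivity
    refine (tail _ hc (by linarith)).trans (ENNReal.ofReal_le_ofReal ?_)
    have h2 : (s / (√D.card * v ^ 2)) ^ 2 ≤ ε ^ 2 := pow_le_pow_left₀ (by positivity) h 2
    calc D.card * (20 * s) ^ 2 / (D.card * (v ^ 2 / 4)) ^ 2
        = 400 * (s / (√D.card * v ^ 2)) ^ 2 * 16 := by
          rw [div_pow, mul_pow (√(D.card : ℝ)), hsq]
          field_simp
          ring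
      _ ≤ 400 * ε ^ 2 * (1 / a ^ 2 + 16) := by
        gcongr
        exact le_add_of_nonneg_left (by positivity)

/-- Disjoint blocks of coordinates are independent, so their joint law is a product and Fubini
freezes the estimator at a value `θ'`. A bound for deterministic `θ'` in `B` and `Θ` then integrates
to the same bound. -/
theorem SplitEstimator.iidLaw_le {M : Model 𝒵 d} (S : SplitEstimator M)
    (G : ProbabilityMeasure 𝒵) (n : ℕ) {θ : Fin d → ℝ} (hθ : θ ∈ M.Θ) {B : Set (Fin d → ℝ)}
    (hB : MeasurableSet B) {a : EReal} {c : ℝ≥0∞}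
    (hc : ∀ θ' ∈ M.Θ, θ' ∈ B →
      iidLaw G (S.N n) {Z | a < ∑ i ∈ S.D₂ n, M.logRatio θ' θ (Z i)} ≤ c) :
    iidLaw G (S.N n) {Z | S.val n Z ∈ B ∧
      a < ∑ i ∈ S.D₂ n, M.logRatio (S.val n Z) θ (Z i)} ≤ c := by
  set P := iidLaw G (S.N n) with hP
  have hprob : IsProbabilityMeasure P := by rw [hP]; unfold iidLaw; infer_instance
  set f : (Fin (S.N n) → 𝒵) → (S.D₁ n → 𝒵) := (S.D₁ n).restrict
  set g : (Fin (S.N n) → 𝒵) → (S.D₂ n → 𝒵) := (S.D₂ n).restrict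
  have hf : Measurable f := Finset.measurable_restrict _
  have hg : Measurable g := Finset.measurable_restrict _
  have hind : ProbabilityTheory.IndepFun f g P :=
    (ProbabilityTheory.iIndepFun_pi (μ := fun _ : Fin (S.N n) => (G : Measure 𝒵))
      (X := fun _ => id) fun _ => aemeasurable_id).indepFun_finset _ _ (S.disjoint n)
      fun i => measurable_pi_apply i
  have hmap := hind.map_prod_eq_prod_map_map hf.aemeasurable hg.aemeasurable
  have : IsProbabilityMeasure (P.map f) := Measure.isProbabilityMeasure_map hf.aemeasurable
  have : IsProbabilityMeasure (P.map g) := Measure.isProbabilityMeasure_map hg.aemeasurable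
  set E : Set ((S.D₁ n → 𝒵) × (S.D₂ n → 𝒵)) :=
    {w | S.est n w.1 ∈ B ∧ a < ∑ i, M.logRatio (S.est n w.1) θ (w.2 i)} with hE
  have hEm : MeasurableSet E := by
    have h1 : Measurable fun w : (S.D₁ n → 𝒵) × (S.D₂ n → 𝒵) => S.est n w.1 :=
      (S.measurable_est n).comp measurable_fst
    suffices h : Measurable fun w : (S.D₁ n → 𝒵) × (S.D₂ n → 𝒵) =>
        ∑ i, M.logRatio (S.est n w.1) θ (w.2 i) from
      (h1 hB).inter (h (measurableSet_Ioi (a := a)))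
    refine Finset.measurable_sum _ fun i _ => ?_
    have h2 : Measurable fun w : (S.D₁ n → 𝒵) × (S.D₂ n → 𝒵) => w.2 i :=
      (measurable_pi_apply i).comp measurable_snd
    -- Joint measurability of the density is given on `Θ` only, so the estimator has to be viewed as
    -- a map into that subtype.
    have h3 : Measurable fun w : (S.D₁ n → 𝒵) × (S.D₂ n → 𝒵) => M.p (S.est n w.1) (w.2 i) :=
      M.measurable_p.comp ((h1.subtype_mk (h := fun w => S.est_mem n w.1)).prodMk h2)
    exact ENNReal.measurable_log.comp (h3.coe_nnreal_ennreal.div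
      ((M.measurable_density hθ).comp h2).coe_nnreal_ennreal)
  have hsum : ∀ (θ' : Fin d → ℝ) (Z : Fin (S.N n) → 𝒵),
      ∑ i, M.logRatio θ' θ (g Z i) = ∑ i ∈ S.D₂ n, M.logRatio θ' θ (Z i) := fun θ' Z =>
    Finset.sum_coe_sort (S.D₂ n) fun i => M.logRatio θ' θ (Z i)
  have hpre : {Z | S.val n Z ∈ B ∧ a < ∑ i ∈ S.D₂ n, M.logRatio (S.val n Z) θ (Z i)}
      = (fun Z => (f Z, g Z)) ⁻¹' E := by
    ext Z
    simp only [hE, Set.preimage_ofPred_eq, Set.mem_ofPred_eq, hsum]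
    rfl
  rw [hpre, ← Measure.map_apply (hf.prodMk hg) hEm, hmap, Measure.prod_apply hEm]
  calc ∫⁻ x, P.map g (Prod.mk x ⁻¹' E) ∂(P.map f) ≤ ∫⁻ _, c ∂(P.map f) := by
        refine lintegral_mono fun x => ?_
        rw [Measure.map_apply hg (measurable_prodMk_left hEm)]
        by_cases hx : S.est n x ∈ B
        · refine (measure_mono ?_).trans (hc _ (S.est_mem n x) hx)
          intro Z hZ
          have h2 : a < ∑ i, M.logRatio (S.est n x) θ (g Z i) := hZ.2
          rw [hsum] at h2
          exact h2
        · have : g ⁻¹' (Prod.mk x ⁻¹' E) = ∅ :=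
            Set.eq_empty_of_forall_notMem fun Z hZ => hx hZ.1
          rw [this, measure_empty]
          exact zero_le
    _ = c := by simp

/-- The bounds at radius `δ n` need room for `4 * δ n`. They are therefore taken at a fixed index
`k` with `δ k > 0`, which `4 * δ n` eventually undercuts; if no such `k` exists, `δ` is eventually
zero. -/
theorem exists_ge_eventually_four_mul_le {δ : ℕ → ℝ≥0} (hδ : Tendsto δ atTop (𝓝 0)) (k₀ : ℕ) :
    ∃ k ≥ k₀, ∀ᶠ n in atTop, 4 * δ n ≤ δ k := by
  by_cases h : ∃ k ≥ k₀, 0 < δ k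
  · obtain ⟨k, hk, hpos⟩ := h
    refine ⟨k, hk, ?_⟩
    have h4 : Tendsto (fun n => 4 * δ n) atTop (𝓝 0) := by simpa using hδ.const_mul 4
    exact (h4.eventually_lt_const hpos).mono fun n hn => hn.le
  · push Not at h
    refine ⟨k₀, le_rfl, ?_⟩
    filter_upwards [eventually_ge_atTop k₀] with n hn
    rw [le_antisymm (h n hn) zero_le]
    simp

theorem IsUniformlyExtremelyConservative.isUniformlyValid {𝒢 : Set (ProbabilityMeasure 𝒵)}
    {θ : ProbabilityMeasure 𝒵 → Fin d → ℝ} {N : ℕ → ℕ}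
    {CI : ∀ n, (Fin (N n) → 𝒵) → Set (Fin d → ℝ)}
    (h : IsUniformlyExtremelyConservative 𝒢 θ N CI) (α : ℝ) : IsUniformlyValid 𝒢 θ N CI α := by
  refine le_antisymm (le_trans ?_ h.le) zero_le
  refine limsup_le_limsup (Eventually.of_forall fun n => ?_)
  exact iSup₂_mono fun G _ => tsub_le_self

end UnivInf

/-! ### Assembly. -/

theorem corollary1 {𝒵 : Type*} [MeasurableSpace 𝒵] {d : ℕ}
    (M : UnivInf.Model 𝒵 d) (S : UnivInf.SplitEstimator M)
    (𝒢 : Set (ProbabilityMeasure 𝒵))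
    (θ : ProbabilityMeasure 𝒵 → Fin d → ℝ)
    (hθ : ∀ G ∈ 𝒢, M.IsKLProjection (G : Measure 𝒵) (θ G))
    (ℓ : ProbabilityMeasure 𝒵 → 𝒵 → Fin d → ℝ)
    (I : ProbabilityMeasure 𝒵 → Matrix (Fin d) (Fin d) ℝ)
    (hI : ∀ G, I G = UnivInf.fisher (G : Measure 𝒵) (ℓ G))
    (V : ProbabilityMeasure 𝒵 → Matrix (Fin d) (Fin d) ℝ)
    (δ : ℕ → ℝ≥0) (hδ : Tendsto δ atTop (𝓝 0))
    (p : ℝ) (hp : 2 ≤ p) (L : ℕ → ProbabilityMeasure 𝒵 → ℝ≥0)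
    (hQMD : UnivInf.IsQMD M 𝒢 θ ℓ δ)
    (hHess : UnivInf.HasHessian M 𝒢 θ V δ)
    (hCons : UnivInf.IsConsistent S 𝒢 θ I V δ)
    (hMom : UnivInf.HasMoments M 𝒢 θ ℓ δ p L)
    (hULC : UnivInf.IsULC 𝒢 ℓ)
    (α : ℝ) (hα0 : 0 < α) (hα1 : α < 1)
    (hrate : ∀ ε : ℝ, 0 < ε →
      limsup (fun n : ℕ => ⨆ G ∈ 𝒢, UnivInf.iidLaw G (S.N n)
        {Z | ε < min
          (Real.sqrt n * UnivInf.scaledNorm (I G) (S.val n Z - θ G))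
          (UnivInf.scaledNorm (I G) (S.val n Z - θ G) /
            (Real.sqrt n * UnivInf.scaledNorm (V G) (S.val n Z - θ G) ^ 2))}) atTop = 0) :
    UnivInf.IsUniformlyExtremelyConservative 𝒢 θ S.N (UnivInf.universalCI S α) ∧
      UnivInf.IsUniformlyValid 𝒢 θ S.N (UnivInf.universalCI S α) α := by
  suffices h : UnivInf.IsUniformlyExtremelyConservative 𝒢 θ S.N (UnivInf.universalCI S α) from
    ⟨h, h.isUniformlyValid α⟩
  have ha : 0 < Real.log (1 / α) := Real.log_pos (by rw [one_div]; exact one_lt_inv₀ hα0 |>.mpr hα1)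
  set a := Real.log (1 / α) with ha_def
  refine le_antisymm (ENNReal.le_of_forall_pos_le_add fun η hη _ => ?_) zero_le
  -- A third of `η` each goes to failure of consistency, failure of the rate condition, and the
  -- Chebyshev tail; `ε` makes the last one fit.
  obtain ⟨ε, hε, hεη⟩ : ∃ ε : ℝ, 0 < ε ∧ 400 * ε ^ 2 * (1 / a ^ 2 + 16) ≤ (η / 3 : ℝ≥0) := by
    have hcont : Tendsto (fun ε : ℝ => 400 * ε ^ 2 * (1 / a ^ 2 + 16)) (𝓝[>] 0) (𝓝 0) := by
      have : Continuous fun ε : ℝ => 400 * ε ^ 2 * (1 / a ^ 2 + 16) := by fun_prop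
      exact (this.tendsto' 0 0 (by simp)).mono_left nhdsWithin_le_nhds
    have hη3 : (0 : ℝ) < (η / 3 : ℝ≥0) := by positivity
    obtain ⟨ε, hε, hε0⟩ := ((hcont.eventually_lt_const hη3).and self_mem_nhdsWithin).exists
    exact ⟨ε, hε0, hε.le⟩
  have hη3 : (0 : ℝ≥0∞) < (η / 3 : ℝ≥0) := by rw [ENNReal.coe_pos]; positivity
  have hθΘ : ∀ G ∈ 𝒢, θ G ∈ M.Θ := fun G hG => (hθ G hG).1
  obtain ⟨k₀, hk₀⟩ := eventually_atTop.mp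
    (UnivInf.eventually_hasLogRatioBounds hθΘ hp hQMD hHess hMom)
  obtain ⟨k, hk, hδk⟩ := UnivInf.exists_ge_eventually_four_mul_le hδ k₀
  rw [zero_add]
  refine limsup_le_of_le (by isBoundedDefault) ?_
  filter_upwards [hδk, eventually_gt_atTop 0,
    eventually_lt_of_limsup_lt ((hrate ε hε).trans_lt hη3),
    eventually_lt_of_limsup_lt (lt_of_eq_of_lt hCons hη3)] with n h4δ hn hrate_n hcons_n
  refine iSup₂_le fun G hG => ?_
  have h1 := (le_iSup₂ (f := fun G (_ : G ∈ 𝒢) => UnivInf.iidLaw G (S.N n) _) G hG).trans hrate_n.le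
  have h2 := (le_iSup₂ (f := fun G (_ : G ∈ 𝒢) => UnivInf.iidLaw G (S.N n) _) G hG).trans hcons_n.le
  -- The good values of the estimator: outside the two failure events it lies in `B`, and on `B` the
  -- tail bound for a fixed parameter applies.
  set B : Set (Fin d → ℝ) := {t | UnivInf.scaledNorm (I G) (t - θ G) ≤ δ n ∧
    UnivInf.scaledNorm (V G) (t - θ G) ≤ δ n ∧
    min (Real.sqrt n * UnivInf.scaledNorm (I G) (t - θ G))
      (UnivInf.scaledNorm (I G) (t - θ G) /
        (Real.sqrt n * UnivInf.scaledNorm (V G) (t - θ G) ^ 2)) ≤ ε} with hB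
  have hBm : MeasurableSet B := by
    have hI' : Measurable fun t => UnivInf.scaledNorm (I G) (t - θ G) :=
      (UnivInf.measurable_scaledNorm _).comp (measurable_id.sub_const _)
    have hV' : Measurable fun t => UnivInf.scaledNorm (V G) (t - θ G) :=
      (UnivInf.measurable_scaledNorm _).comp (measurable_id.sub_const _)
    exact (measurableSet_le hI' measurable_const).inter
      ((measurableSet_le hV' measurable_const).inter
        (measurableSet_le ((hI'.const_mul _).min (hI'.div ((hV'.pow_const 2).const_mul _)))
          measurable_const))
  have h3 := S.iidLaw_le G n (hθΘ G hG) hBm (a := (a : EReal)) (c := (η / 3 : ℝ≥0))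
    fun t ht htB => by
      obtain ⟨hs, hv, hmin⟩ := htB
      rw [hI G] at hs hmin
      have h4 : 4 * (δ n : ℝ) ≤ δ k := by exact_mod_cast h4δ
      have hb := hk₀ k hk G hG (t - θ G) (by linarith)
        (by linarith [(δ n).coe_nonneg])
      rw [add_sub_cancel] at hb
      rw [← S.card_D₂ n] at hn hmin
      refine (UnivInf.iidLaw_logRatio_gt_le G hn (hθΘ G hG) ht
        (UnivInf.scaledNorm_nonneg _ _) (UnivInf.scaledNorm_nonneg _ _) (fun h0 => ?_) hb ha hε.le
        hmin).trans ?_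
      -- Positive definiteness of `V G` turns a zero norm into a zero displacement, so the Fisher
      -- norm vanishes too.
      · rw [UnivInf.eq_zero_of_scaledNorm_eq_zero (hHess.1 G hG) h0]
        simp [UnivInf.scaledNorm]
      · exact (ENNReal.ofReal_le_ofReal hεη).trans_eq (ENNReal.ofReal_coe_nnreal)
  have hη : ((η / 3 : ℝ≥0) : ℝ≥0∞) + (η / 3 : ℝ≥0) + (η / 3 : ℝ≥0) = η := by
    rw [← ENNReal.coe_add, ← ENNReal.coe_add, add_thirds]
  rw [← hη]
  refine le_trans (measure_mono fun Z hZ => ?_) ((measure_union_le _ _).trans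
    (add_le_add ((measure_union_le _ _).trans (add_le_add h2 h1)) h3))
  by_contra hcon
  simp only [Set.mem_union, Set.mem_ofPred_eq, not_or, not_lt, max_le_iff] at hcon
  obtain ⟨⟨⟨hs, hv, -⟩, hmin⟩, hT⟩ := hcon
  rw [← ENNReal.ofReal_coe_nnreal, ENNReal.ofReal_le_ofReal_iff (δ n).coe_nonneg] at hs hv
  refine hZ ⟨hθΘ G hG, ?_⟩
  by_contra hlt
  exact hT ⟨⟨hs, hv, hmin⟩, not_le.mp hlt⟩
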